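/- Let $p$ be an odd prime and let $m$ be a positive odd integer. Then $$ \frac{1}{m^2\binom{m-1}{(m-1)/2}}\left(\sum_{k=0}^{(pm-1)/2}\frac{\binom{2k}{k}}{8^k}-\left(\frac{2}{p}\right)\sum_{k=0}^{(m-1)/2}\frac{\binom{2k}{k}}{8^k}\right)\equiv 0\pmod{p^2}, $$ where $\left(\frac{2}{p}\right)$ is the Jacobi (Legendre) symbol. The congruence is between rational numbers: $x\equiv y\pmod{p^2}$ means that $x-y=p^2a/b$ for some integers $a,b$ with $b\neq 0$ not divisible by $p$. (In particular, the case $p\mid m$ is included.) -/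

import Mathlib

/-- Congruence of rational numbers modulo a natural number `n`: `x ≡ y (mod n)` means that
`x - y = n * a / b` for integers `a` and `b` with `b` coprime to `n`. For `n = p ^ 2` with `p`
prime, this says that `x - y` lies in `p ^ 2 ℤ_(p)`, where `ℤ_(p)` is the ring of rational numbers
whose denominator is not divisible by `p`. -/
def RatModEq (n : ℕ) (x y : ℚ) : Prop :=
  ∃ a b : ℤ, IsCoprime b (n : ℤ) ∧ b ≠ 0 ∧ x - y = (n : ℚ) * ((a : ℚ) / (b : ℚ))

/-- The truncated sum `∑_{k=0}^{N} binom(2k, k) / 8^k`, a rational number. -/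
def binomSum (N : ℕ) : ℚ :=
  ∑ k ∈ Finset.range (N + 1), ((2 * k).choose k : ℚ) / 8 ^ k

/-! The sum up to N is the value at 0 of a polynomial of degree at most N whose value at j², for
each odd j ≤ 2N+1, is the Jacobi symbol (2/j). Lagrange interpolation at these N+1 nodes gives
`binomSum N` = ∑ (2/j) w(j), with w(j) = `nodeWeight (2 * N + 1) j`.

A closed form of w(j) shows that j² 16^N w(j) is an integer multiple of (2N+1)² binom(2N, N)
(`exists_nodeWeight_mul_eq`). Write m = 2M+1 and split the nodes for pm by divisibility by p. If p ∤
j, then j is a p-adic unit, so the weight is divisible by (pm)² binom(2M, M) in ℤ_(p). At pj, the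
weight is that of j for m times 1 + (pj)² r with r in ℤ_(p); since (2/pj) = (2/p)(2/j), the main
terms cancel and p² j² w(j) r remains, divisible by p² m² binom(2M, M). -/

/-- The odd natural numbers that are at most `n`. -/
def oddsLE (n : ℕ) : Finset ℕ := {i ∈ Finset.range (n + 1) | Odd i}

/-- The value at `0` of the Lagrange basis polynomial attached to the node `j ^ 2`, the nodes being
the squares of the odd numbers that are at most `n`. -/
def nodeWeight (n j : ℕ) : ℚ :=
  ∏ i ∈ (oddsLE n).erase j, (i : ℚ) ^ 2 / ((i : ℚ) ^ 2 - (j : ℚ) ^ 2)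

theorem mem_oddsLE {n i : ℕ} : i ∈ oddsLE n ↔ i ≤ n ∧ Odd i := by
  simp [oddsLE]

theorem oddsLE_eq_image (N : ℕ) :
    oddsLE (2 * N + 1) = (Finset.range (N + 1)).image (fun s => 2 * s + 1) := by
  ext i
  simp only [mem_oddsLE, Finset.mem_image, Finset.mem_range]
  constructor
  · rintro ⟨h, s, rfl⟩
    exact ⟨s, by omega, rfl⟩
  · rintro ⟨s, h, rfl⟩
    exact ⟨by omega, s, rfl⟩

theorem card_oddsLE (N : ℕ) : (oddsLE (2 * N + 1)).card = N + 1 := by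
  rw [oddsLE_eq_image, Finset.card_image_of_injective, Finset.card_range]
  intro a b h
  simpa using h

theorem oddsLE_add_two (N : ℕ) :
    oddsLE (2 * (N + 1) + 1) = insert (2 * (N + 1) + 1) (oddsLE (2 * N + 1)) := by
  rw [oddsLE_eq_image, oddsLE_eq_image, Finset.range_add_one, Finset.image_insert]

theorem sq_sub_sq_ne_zero {i j : ℕ} (h : i ≠ j) : (i : ℚ) ^ 2 - (j : ℚ) ^ 2 ≠ 0 := by
  rw [sub_ne_zero]
  exact_mod_cast fun H => h (Nat.pow_left_injective two_ne_zero H)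

/-! ### Closed form of the weights -/

theorem centralBinom_mul_factorial_sq (t : ℕ) :
    (t.centralBinom : ℚ) * (t.factorial * t.factorial) = (2 * t).factorial := by
  have := Nat.choose_mul_factorial_mul_factorial (show t ≤ 2 * t by omega)
  rw [show 2 * t - t = t by omega, mul_assoc] at this
  exact_mod_cast this

theorem prod_odd_mul (t : ℕ) :
    (∏ s ∈ Finset.range t, (2 * s + 1 : ℚ)) * (2 ^ t * (t.factorial : ℚ)) = (2 * t).factorial := by
  induction t with
  | zero => simp
  | succ t ih =>
    rw [Finset.prod_range_succ, show 2 * (t + 1) = 2 * t + 1 + 1 by ring, Nat.factorial_succ,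
      Nat.factorial_succ, Nat.factorial_succ]
    push_cast
    rw [← ih]
    ring

/-- Each factor equals -4 (t - s) (t + s + 1), so the product is a ratio of factorials. -/
theorem prod_sq_sub_sq_mul (t k : ℕ) (h : k ≤ t) :
    (∏ s ∈ Finset.range k, ((2 * s + 1 : ℚ) ^ 2 - (2 * t + 1) ^ 2)) * ((t - k).factorial : ℚ) =
      (-4) ^ k * (t + k).factorial := by
  induction k with
  | zero => simp
  | succ k ih =>
    obtain ⟨e, rfl⟩ := Nat.exists_eq_add_of_le h
    have ih := ih (by omega)
    rw [show k + 1 + e - k = e + 1 by omega, Nat.factorial_succ] at ih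
    rw [Finset.prod_range_succ, show k + 1 + e - (k + 1) = e by omega,
      show k + 1 + e + (k + 1) = (k + 1 + e + k) + 1 by ring, Nat.factorial_succ]
    push_cast at ih ⊢
    linear_combination (-4 * (k + 1 + e + k + 1 : ℚ)) * ih

theorem nodeWeight_self (t : ℕ) :
    nodeWeight (2 * t + 1) (2 * t + 1) = (-1) ^ t * (t.centralBinom : ℚ) / 16 ^ t := by
  have h1 : (oddsLE (2 * t + 1)).erase (2 * t + 1) =
      (Finset.range t).image (fun s => 2 * s + 1) := by
    rw [oddsLE_eq_image, Finset.range_add_one, Finset.image_insert, Finset.erase_insert]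
    simp
  have hinj : Set.InjOn (fun s : ℕ => 2 * s + 1) (Finset.range t : Set ℕ) := by
    intro a _ b _ h
    simpa using h
  rw [nodeWeight, h1, Finset.prod_image hinj]
  push_cast
  rw [Finset.prod_div_distrib, Finset.prod_pow]
  have hA := prod_odd_mul t
  have hB := prod_sq_sub_sq_mul t t le_rfl
  have hC := centralBinom_mul_factorial_sq t
  rw [Nat.sub_self, Nat.factorial_zero, Nat.cast_one, mul_one, ← two_mul] at hB
  rw [hB, ← hC]
  rw [← hC] at hA
  have hf : (t.factorial : ℚ) ≠ 0 := by exact_mod_cast t.factorial_ne_zero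
  have hc : (t.centralBinom : ℚ) ≠ 0 := by exact_mod_cast t.centralBinom_ne_zero
  have hP : (∏ s ∈ Finset.range t, (2 * s + 1 : ℚ)) = t.centralBinom * t.factorial / 2 ^ t := by
    rw [eq_div_iff (by positivity)]
    apply mul_right_cancel₀ hf
    linear_combination hA
  rw [hP, show (-4 : ℚ) = (-1) * 4 by norm_num, show (16 : ℚ) = 4 * 4 by norm_num, mul_pow, mul_pow,
    div_pow, ← pow_mul, mul_comm t 2, pow_mul]
  field_simp
  norm_num
  exact neg_one_pow_eq_or ℚ t

theorem nodeWeight_succ {N t : ℕ} (h : t ≤ N) :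
    nodeWeight (2 * (N + 1) + 1) (2 * t + 1) = nodeWeight (2 * N + 1) (2 * t + 1) *
      ((2 * N + 3) ^ 2 / (4 * (N + 1 - t) * (N + t + 2))) := by
  rw [nodeWeight, nodeWeight, oddsLE_add_two, Finset.erase_insert_of_ne (by omega),
    Finset.prod_insert, mul_comm]
  · push_cast
    congr 1
    ring
  · simp [mem_oddsLE]

/-- The closed form of the weights, for the node `2 * t + 1` and the bound `2 * (t + d) + 1`. -/
theorem nodeWeight_eq (t d : ℕ) :
    nodeWeight (2 * (t + d) + 1) (2 * t + 1) =
      (-1) ^ t * (2 * (t + d) + 1) * ((t + d).centralBinom : ℚ) *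
        ((2 * (t + d) + 1).choose d : ℚ) / ((2 * t + 1) * 16 ^ (t + d)) := by
  induction d with
  | zero =>
    rw [add_zero, nodeWeight_self, Nat.choose_zero_right]
    push_cast
    have : (2 * t + 1 : ℚ) ≠ 0 := by positivity
    field_simp
    ring
  | succ d ih =>
    rw [← add_assoc, nodeWeight_succ (by omega), ih]
    have h1 : ((t + d + 1 : ℕ) : ℚ) * (t + d + 1).centralBinom =
        2 * (2 * (t + d) + 1) * (t + d).centralBinom := by
      exact_mod_cast Nat.succ_mul_centralBinom_succ (t + d)
    have h2 : ((2 * (t + d + 1) + 1).choose (d + 1) : ℚ) * ((d + 1) * (2 * t + d + 2)) =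
        (2 * (t + d + 1) + 1) * (2 * (t + d + 1)) * ((2 * (t + d) + 1).choose d : ℚ) := by
      have e1 := Nat.add_one_mul_choose_eq (2 * (t + d + 1)) d
      have e2 := Nat.choose_mul_succ_eq (2 * (t + d) + 1) d
      rw [show 2 * (t + d) + 1 + 1 - d = 2 * t + d + 2 by omega] at e2
      rw [show 2 * (t + d + 1) = 2 * (t + d) + 1 + 1 by ring] at e1 ⊢
      have e1 : ((2 * (t + d) + 1 + 1 + 1 : ℕ) : ℚ) * ((2 * (t + d) + 1 + 1).choose d : ℚ) =
        ((2 * (t + d) + 1 + 1 + 1).choose (d + 1) : ℚ) * ((d + 1 : ℕ) : ℚ) := by exact_mod_cast e1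
      have e2 : ((2 * (t + d) + 1).choose d : ℚ) * ((2 * (t + d) + 1 + 1 : ℕ) : ℚ) =
        ((2 * (t + d) + 1 + 1).choose d : ℚ) * ((2 * t + d + 2 : ℕ) : ℚ) := by exact_mod_cast e2
      push_cast at e1 e2 ⊢
      linear_combination (-(2 * t + d + 2 : ℚ)) * e1 - (2 * (t + d) + 1 + 1 + 1 : ℚ) * e2
    have hd : (d + 1 : ℚ) ≠ 0 := by positivity
    have htd : (t + d + 1 : ℚ) ≠ 0 := by positivity
    have ht : (2 * t + d + 2 : ℚ) ≠ 0 := by positivity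
    have ht1 : (2 * t + 1 : ℚ) ≠ 0 := by positivity
    push_cast at h1
    have h1' : ((t + d + 1).centralBinom : ℚ) =
        2 * (2 * (t + d) + 1) * (t + d).centralBinom / (t + d + 1) := by
      rw [eq_div_iff htd]; linear_combination h1
    have h2' : ((2 * (t + d + 1) + 1).choose (d + 1) : ℚ) = (2 * (t + d + 1) + 1) *
        (2 * (t + d + 1)) * ((2 * (t + d) + 1).choose d : ℚ) / ((d + 1) * (2 * t + d + 2)) := by
      rw [eq_div_iff (by positivity)]; exact h2
    rw [h1', h2']
    push_cast
    rw [show (t + d + 1 - t : ℚ) = d + 1 by ring, show (t + d + t + 2 : ℚ) = 2 * t + d + 2 by ring,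
      pow_succ]
    field_simp
    ring

/-! ### Lagrange interpolation -/

/-- `∑ k, binom(2k, k) / 8 ^ k * ∏_{j < k} (1 - X / (2j + 1) ^ 2)`. -/
noncomputable def interpPoly (N : ℕ) : Polynomial ℚ :=
  ∑ k ∈ Finset.range (N + 1), Polynomial.C (((2 * k).choose k : ℚ) / 8 ^ k) *
    ∏ j ∈ Finset.range k, (1 - Polynomial.C (1 / (2 * j + 1 : ℚ) ^ 2) * Polynomial.X)

theorem eval_zero_interpPoly (N : ℕ) : (interpPoly N).eval 0 = binomSum N := by
  simp [interpPoly, binomSum, Polynomial.eval_finsetSum, Polynomial.eval_prod]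

theorem degree_interpPoly_lt (N : ℕ) : (interpPoly N).degree < (N + 1 : ℕ) := by
  rw [interpPoly, Polynomial.degree_lt_iff_coeff_zero]
  intro n hn
  rw [Polynomial.finsetSum_coeff]
  refine Finset.sum_eq_zero fun k hk => ?_
  rw [Polynomial.coeff_C_mul, Polynomial.coeff_eq_zero_of_natDegree_lt, mul_zero]
  have h1 : (∏ j ∈ Finset.range k, (1 - Polynomial.C (1 / (2 * j + 1 : ℚ) ^ 2) *
      Polynomial.X)).natDegree ≤ ∑ j ∈ Finset.range k, 1 := by
    refine (Polynomial.natDegree_prod_le _ _).trans (Finset.sum_le_sum fun j _ => ?_)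
    compute_degree
  simp only [Finset.sum_const, Finset.card_range, smul_eq_mul, mul_one] at h1
  have := Finset.mem_range.1 hk
  omega

/-- Consecutive terms on the two sides have the same ratio in k. This turns the value at (2t+1)²
into an alternating sum of binomials. -/
theorem choose_mul_prod (t k : ℕ) :
    ((2 * k).choose k : ℚ) / 8 ^ k *
      ∏ j ∈ Finset.range k, (1 - 1 / (2 * j + 1 : ℚ) ^ 2 * (2 * t + 1) ^ 2) =
    ((t + k).choose (2 * k) : ℚ) * (-2) ^ k := by
  induction k with
  | zero => simp
  | succ k ih =>
    have h1 : ((k + 1 : ℕ) : ℚ) * ((2 * (k + 1)).choose (k + 1) : ℚ) =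
        2 * (2 * k + 1) * ((2 * k).choose k : ℚ) := by
      exact_mod_cast Nat.succ_mul_centralBinom_succ k
    have h2 : ((t + (k + 1)).choose (2 * (k + 1)) : ℚ) * ((2 * k + 2) * (2 * k + 1)) =
        ((t + k).choose (2 * k) : ℚ) * ((t + k + 1) * (t - k)) := by
      have e1 := Nat.add_one_mul_choose_eq (t + k) (2 * k + 1)
      have e2 := Nat.choose_succ_right_eq (t + k) (2 * k)
      have e1 : ((t + k + 1 : ℕ) : ℚ) * ((t + k).choose (2 * k + 1) : ℚ) =
        ((t + k + 1).choose (2 * k + 1 + 1) : ℚ) * ((2 * k + 1 + 1 : ℕ) : ℚ) := by exact_mod_cast e1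
      have e2 : ((t + k).choose (2 * k + 1) : ℚ) * (2 * k + 1) =
          ((t + k).choose (2 * k) : ℚ) * (t - k) := by
        -- Natural subtraction is faithful only for k ≤ t; for k > t both binomials vanish.
        rcases le_or_gt k t with h | h
        · rw [show t + k - 2 * k = t - k by omega] at e2
          have : ((t + k).choose (2 * k + 1) : ℚ) * ((2 * k + 1 : ℕ) : ℚ) =
            ((t + k).choose (2 * k) : ℚ) * ((t - k : ℕ) : ℚ) := by exact_mod_cast e2
          rw [Nat.cast_sub h] at this
          exact_mod_cast this
        · rw [Nat.choose_eq_zero_of_lt (by omega), Nat.choose_eq_zero_of_lt (by omega)]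
          simp
      rw [show t + (k + 1) = t + k + 1 by ring, show 2 * (k + 1) = 2 * k + 1 + 1 by ring]
      push_cast at e1
      linear_combination (-(2 * k + 1 : ℚ)) * e1 + (t + k + 1 : ℚ) * e2
    have hk : (k + 1 : ℚ) ≠ 0 := by positivity
    have hk2 : (2 * k + 1 : ℚ) ≠ 0 := by positivity
    push_cast at h1
    have h1' : ((2 * (k + 1)).choose (k + 1) : ℚ) =
        2 * (2 * k + 1) * ((2 * k).choose k : ℚ) / (k + 1) := by
      rw [eq_div_iff hk]; linear_combination h1
    have h2' : ((t + (k + 1)).choose (2 * (k + 1)) : ℚ) = ((t + k).choose (2 * k) : ℚ) *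
        ((t + k + 1) * (t - k)) / ((2 * k + 2) * (2 * k + 1)) := by
      rw [eq_div_iff (by positivity)]; exact h2
    rw [Finset.prod_range_succ, h1', h2']
    calc _ = (((2 * k).choose k : ℚ) / 8 ^ k *
          ∏ j ∈ Finset.range k, (1 - 1 / (2 * j + 1 : ℚ) ^ 2 * (2 * t + 1) ^ 2)) *
          ((2 * k + 1) / (4 * (k + 1)) * (1 - 1 / (2 * k + 1 : ℚ) ^ 2 * (2 * t + 1) ^ 2)) := by
          rw [pow_succ]
          field_simp
          ring
      _ = _ := by
          rw [ih, pow_succ]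
          field_simp
          ring

/-- Values of the Morgan-Voyce polynomials at `-2`. -/
theorem sum_choose_mul_neg_two_pow (t : ℕ) : ∀ K, t < K →
    (∑ k ∈ Finset.range K, ((t + k).choose (2 * k) : ℚ) * (-2) ^ k =
        if t % 4 = 0 ∨ t % 4 = 3 then 1 else -1) ∧
    (∑ k ∈ Finset.range K, ((t + k + 1).choose (2 * k + 1) : ℚ) * (-2) ^ k =
        if t % 4 = 0 then 1 else if t % 4 = 2 then -1 else 0) := by
  induction t with
  | zero =>
    intro K hK
    obtain ⟨K, rfl⟩ : ∃ L, K = L + 1 := ⟨K - 1, by omega⟩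
    constructor
    · rw [Finset.sum_eq_single_of_mem 0 (by simp)]
      · simp
      · intro b _ hb
        rw [Nat.choose_eq_zero_of_lt (by omega)]
        simp
    · rw [Finset.sum_eq_single_of_mem 0 (by simp)]
      · simp
      · intro b _ hb
        rw [Nat.choose_eq_zero_of_lt (by omega)]
        simp
  | succ t ih =>
    intro K hK
    obtain ⟨K, rfl⟩ : ∃ L, K = L + 1 := ⟨K - 1, by omega⟩
    obtain ⟨hB, -⟩ := ih (K + 1) (by omega)
    obtain ⟨-, hA'⟩ := ih K (by omega)
    obtain ⟨-, hA⟩ := ih (K + 1) (by omega)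
    -- Pascal's rule couples the two sums in a recursion of period 4 in t. Shifting the index
    -- shortens one range by one, hence the quantifier over K.
    have key : ∑ k ∈ Finset.range (K + 1), ((t + 1 + k).choose (2 * k) : ℚ) * (-2) ^ k =
        ∑ k ∈ Finset.range (K + 1), ((t + k).choose (2 * k) : ℚ) * (-2) ^ k -
        2 * ∑ k ∈ Finset.range K, ((t + k + 1).choose (2 * k + 1) : ℚ) * (-2) ^ k := by
      rw [Finset.sum_range_succ', Finset.sum_range_succ' _ K, Finset.mul_sum]
      simp only [mul_zero, Nat.choose_zero_right]
      rw [add_sub_right_comm, ← Finset.sum_sub_distrib]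
      congr 1
      refine Finset.sum_congr rfl fun k _ => ?_
      rw [show t + 1 + (k + 1) = t + k + 1 + 1 by ring, show 2 * (k + 1) = 2 * k + 1 + 1 by ring,
        Nat.choose_succ_succ, show t + (k + 1) = t + k + 1 by ring]
      push_cast
      ring
    have key2 : ∑ k ∈ Finset.range (K + 1), ((t + 1 + k + 1).choose (2 * k + 1) : ℚ) * (-2) ^ k =
        ∑ k ∈ Finset.range (K + 1), ((t + k + 1).choose (2 * k + 1) : ℚ) * (-2) ^ k +
        ∑ k ∈ Finset.range (K + 1), ((t + 1 + k).choose (2 * k) : ℚ) * (-2) ^ k := by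
      rw [← Finset.sum_add_distrib]
      refine Finset.sum_congr rfl fun k _ => ?_
      rw [Nat.choose_succ_succ, show t + 1 + k = t + k + 1 by ring]
      push_cast
      ring
    rw [key2, hA, key, hB, hA']
    have h4 : t % 4 < 4 := Nat.mod_lt _ (by norm_num)
    have h5 : (t + 1) % 4 = (t % 4 + 1) % 4 := by omega
    rw [h5]
    generalize t % 4 = r at h4
    interval_cases r <;> norm_num

theorem jacobiSym_two_odd (t : ℕ) :
    (jacobiSym 2 (2 * t + 1) : ℚ) = if t % 4 = 0 ∨ t % 4 = 3 then 1 else -1 := by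
  rw [jacobiSym.at_two (odd_two_mul_add_one t), ZMod.χ₈_nat_eq_if_mod_eight]
  have h4 : t % 4 < 4 := Nat.mod_lt _ (by norm_num)
  have h5 : (2 * t + 1) % 8 = 2 * (t % 4) + 1 := by omega
  have h6 : (2 * t + 1) % 2 = 1 := by omega
  rw [h5, h6]
  generalize t % 4 = r at h4
  interval_cases r <;> norm_num

theorem eval_interpPoly {N t : ℕ} (h : t ≤ N) :
    (interpPoly N).eval ((2 * t + 1 : ℚ) ^ 2) = jacobiSym 2 (2 * t + 1) := by
  rw [jacobiSym_two_odd, ← (sum_choose_mul_neg_two_pow t (N + 1) (by omega)).1, interpPoly,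
    Polynomial.eval_finsetSum]
  refine Finset.sum_congr rfl fun k _ => ?_
  rw [← choose_mul_prod]
  simp [Polynomial.eval_prod]

theorem binomSum_eq_sum_nodeWeight (N : ℕ) :
    binomSum N = ∑ j ∈ oddsLE (2 * N + 1), (jacobiSym 2 j : ℚ) * nodeWeight (2 * N + 1) j := by
  have hinj : Set.InjOn (fun i : ℕ => (i : ℚ) ^ 2) (oddsLE (2 * N + 1) : Set ℕ) := by
    intro i _ j _ h
    by_contra hne
    exact sq_sub_sq_ne_zero hne (sub_eq_zero.2 h)
  have key := Lagrange.eq_interpolate_of_eval_eq (f := interpPoly N) (s := oddsLE (2 * N + 1))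
    (v := fun i : ℕ => (i : ℚ) ^ 2) (r := fun j => (jacobiSym 2 j : ℚ)) hinj
    (by rw [card_oddsLE]; exact degree_interpPoly_lt N)
    (by
      intro i hi
      obtain ⟨hi, t, rfl⟩ := mem_oddsLE.1 hi
      have := eval_interpPoly (N := N) (t := t) (by omega)
      push_cast
      exact this)
  rw [← eval_zero_interpPoly, key, Lagrange.interpolate_apply, Polynomial.eval_finsetSum]
  refine Finset.sum_congr rfl fun j hj => ?_
  rw [Polynomial.eval_mul, Polynomial.eval_C, Lagrange.basis, Polynomial.eval_prod, nodeWeight]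
  congr 1
  refine Finset.prod_congr rfl fun i hi => ?_
  have hne := sq_sub_sq_ne_zero (Finset.ne_of_mem_erase hi)
  have hne' := sq_sub_sq_ne_zero (Finset.ne_of_mem_erase hi).symm
  simp only [Lagrange.basisDivisor, Polynomial.eval_mul, Polynomial.eval_C, Polynomial.eval_sub,
    Polynomial.eval_X]
  field_simp
  ring

/-! ### Divisibility of the weights -/

theorem dvd_mul_choose (n d : ℕ) : n ∣ d * n.choose d := by
  rcases d with _ | d
  · simp
  rcases n with _ | n
  · simp
  exact ⟨n.choose d, by rw [Nat.add_one_mul_choose_eq, mul_comm]⟩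

theorem exists_nodeWeight_mul_eq {N j : ℕ} (hj : j ∈ oddsLE (2 * N + 1)) :
    ∃ z : ℤ, nodeWeight (2 * N + 1) j * ((j : ℚ) ^ 2 * 16 ^ N) =
      ((2 * N + 1 : ℕ) : ℚ) ^ 2 * (N.centralBinom : ℚ) * z := by
  obtain ⟨hj, t, rfl⟩ := mem_oddsLE.1 hj
  obtain ⟨d, rfl⟩ := Nat.exists_eq_add_of_le (show t ≤ N by omega)
  obtain ⟨y, hy⟩ := dvd_mul_choose (2 * (t + d) + 1) d
  have hy : (d : ℚ) * ((2 * (t + d) + 1).choose d : ℚ) = ((2 * (t + d) + 1 : ℕ) : ℚ) * y := by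
    exact_mod_cast hy
  -- With n = 2(t+d)+1, the identity 2t+1 = n - 2d gives (2t+1) binom(n, d) = n (binom(n, d) - 2y),
  -- the source of the second factor n.
  refine ⟨(-1) ^ t * ((2 * (t + d) + 1).choose d - 2 * y), ?_⟩
  rw [nodeWeight_eq]
  have ht1 : (2 * t + 1 : ℚ) ≠ 0 := by positivity
  push_cast at hy ⊢
  field_simp
  linear_combination (-2 * (t + d).centralBinom : ℚ) * hy

theorem odd_mul_odd_eq {p q : ℕ} (hp : p = 2 * q + 1) (M : ℕ) :
    p * (2 * M + 1) = 2 * (p * M + q) + 1 := by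
  rw [hp]
  ring

/-! ### The ring of `p`-integral rational numbers -/

/-- The subring `ℤ_(p)` of `ℚ`. -/
noncomputable def pIntegers (p : ℕ) [Fact p.Prime] : Subring ℚ := (Rat.padicValuation p).integer

section

variable {p : ℕ} [Fact p.Prime]

theorem mem_pIntegers {x : ℚ} : x ∈ pIntegers p ↔ ¬ p ∣ x.den :=
  Rat.padicValuation_le_one_iff

theorem inv_mem_pIntegers {b : ℤ} (h : ¬ (p : ℤ) ∣ b) : (b : ℚ)⁻¹ ∈ pIntegers p := by
  change Rat.padicValuation p (b : ℚ)⁻¹ ≤ 1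
  rw [map_inv₀, Rat.padicValuation_cast, Int.padicValuation_eq_one_iff.2 h, inv_one]

theorem exists_prod_one_add_mul_eq {ι : Type*} (R : Subring ℚ) (s : Finset ι) {c : ℚ} (hc : c ∈ R)
    (f : ι → ℚ) (hf : ∀ i ∈ s, f i ∈ R) : ∃ r ∈ R, ∏ i ∈ s, (1 + c * f i) = 1 + c * r := by
  classical
  induction s using Finset.induction_on with
  | empty => exact ⟨0, R.zero_mem, by simp⟩
  | insert a s ha ih =>
    obtain ⟨r, hr, h⟩ := ih fun i hi => hf i (Finset.mem_insert_of_mem hi)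
    have hfa := hf a (Finset.mem_insert_self a s)
    refine ⟨f a + r + c * f a * r,
      R.add_mem (R.add_mem hfa hr) (R.mul_mem (R.mul_mem hc hfa) hr), ?_⟩
    rw [Finset.prod_insert ha, h]
    ring

theorem ratModEq_zero_of_mem {x q : ℚ} (hq : q ∈ pIntegers p) (h : x = (p : ℚ) ^ 2 * q) :
    RatModEq (p ^ 2) x 0 := by
  refine ⟨q.num, q.den, ?_, by exact_mod_cast q.den_ne_zero, ?_⟩
  · rw [Nat.isCoprime_iff_coprime]
    exact ((Nat.Prime.coprime_iff_not_dvd Fact.out).2 (mem_pIntegers.1 hq)).symm.pow_right 2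
  · rw [sub_zero, h, Int.cast_natCast, Rat.num_div_den]
    push_cast
    rfl

/-! ### Factorials and central binomial coefficients -/

/-- The multiples of p contribute p^n n!; the other factors are prime to p. -/
theorem factorial_mul_add (n : ℕ) : ∀ r < p, ∃ c : ℕ, ¬ p ∣ c ∧
    (p * n + r).factorial = p ^ n * n.factorial * c := by
  have hp : p.Prime := Fact.out
  have step : ∀ n, (∃ c : ℕ, ¬ p ∣ c ∧ (p * n).factorial = p ^ n * n.factorial * c) →
      ∀ r < p, ∃ c : ℕ, ¬ p ∣ c ∧ (p * n + r).factorial = p ^ n * n.factorial * c := by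
    intro n h0 r
    induction r with
    | zero => exact fun _ => h0
    | succ r ih =>
      intro hr
      obtain ⟨c, hc, h⟩ := ih (by omega)
      refine ⟨c * (p * n + r + 1), hp.not_dvd_mul hc ?_, ?_⟩
      · rw [add_assoc, Nat.dvd_add_right (dvd_mul_right p n)]
        exact Nat.not_dvd_of_pos_of_lt (by omega) hr
      · rw [← add_assoc, Nat.factorial_succ, h]
        ring
  induction n with
  | zero => exact step 0 ⟨1, hp.one_lt.ne' ∘ Nat.dvd_one.1, by simp⟩
  | succ n ih =>
    obtain ⟨q, hq⟩ : ∃ q, p = q + 1 := ⟨p - 1, by have := hp.pos; omega⟩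
    obtain ⟨c, hc, h⟩ := ih q (by omega)
    refine step (n + 1) ⟨c, hc, ?_⟩
    rw [show p * (n + 1) = p * n + q + 1 by rw [mul_add, mul_one, add_assoc, ← hq],
      Nat.factorial_succ, h, Nat.factorial_succ, show p * n + q + 1 = p * (n + 1) by
        rw [mul_add, mul_one, add_assoc, ← hq]]
    ring

/-- Since 2q < p, doubling pM + q carries nothing into the multiple of p, so the powers of p in the
factorials cancel. -/
theorem centralBinom_mul_add {q : ℕ} (hq : 2 * q < p) (M : ℕ) :
    ∃ r ∈ pIntegers p, ((p * M + q).centralBinom : ℚ) = M.centralBinom * r := by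
  obtain ⟨c, -, h1⟩ := factorial_mul_add (p := p) (2 * M) (2 * q) hq
  obtain ⟨d, hd, h2⟩ := factorial_mul_add (p := p) M q (by omega)
  have hp0 : (p : ℚ) ≠ 0 := by exact_mod_cast (Fact.out : p.Prime).ne_zero
  have hd0 : (d : ℚ) ≠ 0 := by
    rintro h
    exact hd (by rw [Nat.cast_eq_zero.1 h]; exact dvd_zero p)
  have hf : (M.factorial : ℚ) ≠ 0 := by exact_mod_cast M.factorial_ne_zero
  refine ⟨c * ((d : ℤ) : ℚ)⁻¹ ^ 2, Subring.mul_mem _ (natCast_mem _ c)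
    (Subring.pow_mem _ (inv_mem_pIntegers (by exact_mod_cast hd)) 2), ?_⟩
  have e1 := centralBinom_mul_factorial_sq (p * M + q)
  rw [show 2 * (p * M + q) = p * (2 * M) + 2 * q by ring, h1, h2] at e1
  push_cast at e1 ⊢
  rw [← centralBinom_mul_factorial_sq M] at e1
  have hP : ((p : ℚ) ^ M * M.factorial) ^ 2 ≠ 0 := by positivity
  field_simp
  apply mul_left_cancel₀ hP
  linear_combination e1

/-! ### Comparison of the weights for `p * m` and `m` -/

theorem filter_dvd_oddsLE (hp : Odd p) (m : ℕ) :
    {i ∈ oddsLE (p * m) | p ∣ i} = (oddsLE m).image (p * ·) := by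
  have hpos : 0 < p := (Fact.out : p.Prime).pos
  ext i
  simp only [Finset.mem_filter, Finset.mem_image, mem_oddsLE]
  constructor
  · rintro ⟨⟨h, ho⟩, k, rfl⟩
    exact ⟨k, ⟨Nat.le_of_mul_le_mul_left h hpos, (Nat.odd_mul.1 ho).2⟩, rfl⟩
  · rintro ⟨k, ⟨h, ho⟩, rfl⟩
    exact ⟨⟨Nat.mul_le_mul_left p h, hp.mul ho⟩, dvd_mul_right p k⟩

/-- Nodes divisible by p reproduce the weight for m; every other factor is 1 + (pj)²/(i² - (pj)²)
with a p-adic unit as denominator. The j² is kept to cancel the j² in the denominator of the weight,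
which matters when p ∣ j. -/
theorem nodeWeight_mul (hp : Odd p) (m j : ℕ) :
    ∃ r ∈ pIntegers p, nodeWeight (p * m) (p * j) =
      nodeWeight m j * (1 + (p * j : ℚ) ^ 2 * r) := by
  have hpr : p.Prime := Fact.out
  have hp0 : (p : ℚ) ≠ 0 := by exact_mod_cast hpr.ne_zero
  have hinj : Function.Injective (p * · : ℕ → ℕ) := fun a b h =>
    Nat.eq_of_mul_eq_mul_left hpr.pos h
  have hmem : ((p * j : ℚ) ^ 2) ∈ pIntegers p :=
    Subring.pow_mem _ (Subring.mul_mem _ (natCast_mem _ p) (natCast_mem _ j)) 2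
  obtain ⟨r, hr, h⟩ := exists_prod_one_add_mul_eq (pIntegers p) {i ∈ oddsLE (p * m) | ¬ p ∣ i}
    hmem (fun i => ((((i : ℤ) ^ 2 - (p * j : ℤ) ^ 2 : ℤ)) : ℚ)⁻¹) (by
      intro i hi
      apply inv_mem_pIntegers
      intro hdvd
      have h2 : (p : ℤ) ∣ (i : ℤ) ^ 2 := by
        have h3 : (p : ℤ) ∣ (p * j : ℤ) ^ 2 := Dvd.dvd.pow (dvd_mul_right _ _) two_ne_zero
        simpa using dvd_add hdvd h3
      exact (Finset.mem_filter.1 hi).2 (hpr.dvd_of_dvd_pow (by exact_mod_cast h2)))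
  refine ⟨r, hr, ?_⟩
  have hd : {i ∈ (oddsLE (p * m)).erase (p * j) | p ∣ i} =
      ((oddsLE m).erase j).image (p * ·) := by
    rw [Finset.filter_erase, filter_dvd_oddsLE hp, Finset.image_erase hinj]
  have hnd : {i ∈ (oddsLE (p * m)).erase (p * j) | ¬ p ∣ i} =
      {i ∈ oddsLE (p * m) | ¬ p ∣ i} := by
    rw [Finset.filter_erase, Finset.erase_eq_of_notMem]
    simp
  rw [nodeWeight, ← Finset.prod_filter_mul_prod_filter_not _ (p ∣ ·), hd, hnd,
    Finset.prod_image hinj.injOn, ← h, nodeWeight]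
  congr 1
  · refine Finset.prod_congr rfl fun i _ => ?_
    push_cast
    rw [mul_pow, mul_pow, ← mul_sub, mul_div_mul_left _ _ (pow_ne_zero 2 hp0)]
  · refine Finset.prod_congr rfl fun i hi => ?_
    have hne : i ≠ p * j := by
      rintro rfl
      exact (Finset.mem_filter.1 hi).2 (dvd_mul_right p j)
    have := sq_sub_sq_ne_zero hne
    push_cast at this ⊢
    rw [div_eq_mul_inv]
    linear_combination (mul_inv_cancel₀ this)

theorem inv_sixteen_pow_mem (hp : Odd p) (N : ℕ) : ((16 : ℚ) ^ N)⁻¹ ∈ pIntegers p := by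
  have hpr : p.Prime := Fact.out
  have h : ¬ (p : ℤ) ∣ 16 := by
    intro h
    have h1 : p ∣ 2 ^ 4 := by exact_mod_cast h
    rw [(Nat.prime_dvd_prime_iff_eq hpr Nat.prime_two).1 (hpr.dvd_of_dvd_pow h1)] at hp
    exact absurd hp (by decide)
  rw [← inv_pow]
  exact_mod_cast Subring.pow_mem _ (inv_mem_pIntegers h) N

theorem nodeWeight_div_mem {q M : ℕ} (hp : p = 2 * q + 1) {j : ℕ}
    (hj : j ∈ oddsLE (p * (2 * M + 1))) (hpj : ¬ p ∣ j) :
    nodeWeight (p * (2 * M + 1)) j /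
      ((p : ℚ) ^ 2 * (((2 * M + 1 : ℕ) : ℚ) ^ 2 * M.centralBinom)) ∈ pIntegers p := by
  have hN := odd_mul_odd_eq hp M
  rw [hN] at hj
  obtain ⟨z, hz⟩ := exists_nodeWeight_mul_eq hj
  obtain ⟨r, hr, hC⟩ := centralBinom_mul_add (p := p) (show 2 * q < p by omega) M
  rw [← hN, hC] at hz
  have hj0 : (j : ℚ) ≠ 0 := by
    rintro h
    exact hpj (by rw [Nat.cast_eq_zero.1 h]; exact dvd_zero p)
  have hp0 : (p : ℚ) ≠ 0 := by exact_mod_cast (Fact.out : p.Prime).ne_zero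
  have hc : (M.centralBinom : ℚ) ≠ 0 := by exact_mod_cast M.centralBinom_ne_zero
  have hm : ((2 * M + 1 : ℕ) : ℚ) ≠ 0 := by positivity
  have key : nodeWeight (p * (2 * M + 1)) j /
      ((p : ℚ) ^ 2 * (((2 * M + 1 : ℕ) : ℚ) ^ 2 * M.centralBinom)) =
      r * z * (((j : ℤ) : ℚ)⁻¹ ^ 2 * ((16 : ℚ) ^ (p * M + q))⁻¹) := by
    rw [Nat.cast_mul] at hz
    rw [Int.cast_natCast]
    generalize ((2 * M + 1 : ℕ) : ℚ) = x at *
    field_simp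
    linear_combination hz
  rw [key]
  exact Subring.mul_mem _ (Subring.mul_mem _ hr (intCast_mem _ z)) (Subring.mul_mem _
    (Subring.pow_mem _ (inv_mem_pIntegers (by exact_mod_cast hpj)) 2)
    (inv_sixteen_pow_mem ⟨q, hp⟩ _))

theorem nodeWeight_sub_div_mem (hp : Odd p) {M j : ℕ} (hj : j ∈ oddsLE (2 * M + 1)) :
    (nodeWeight (p * (2 * M + 1)) (p * j) - nodeWeight (2 * M + 1) j) /
      ((p : ℚ) ^ 2 * (((2 * M + 1 : ℕ) : ℚ) ^ 2 * M.centralBinom)) ∈ pIntegers p := by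
  obtain ⟨z, hz⟩ := exists_nodeWeight_mul_eq hj
  obtain ⟨r, hr, h⟩ := nodeWeight_mul hp (2 * M + 1) j
  have hp0 : (p : ℚ) ≠ 0 := by exact_mod_cast (Fact.out : p.Prime).ne_zero
  have hc : (M.centralBinom : ℚ) ≠ 0 := by exact_mod_cast M.centralBinom_ne_zero
  have hm : ((2 * M + 1 : ℕ) : ℚ) ≠ 0 := by positivity
  have key : (nodeWeight (p * (2 * M + 1)) (p * j) - nodeWeight (2 * M + 1) j) /
      ((p : ℚ) ^ 2 * (((2 * M + 1 : ℕ) : ℚ) ^ 2 * M.centralBinom)) =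
      r * z * ((16 : ℚ) ^ M)⁻¹ := by
    rw [h]
    generalize ((2 * M + 1 : ℕ) : ℚ) = x at *
    field_simp
    linear_combination (p : ℚ) ^ 2 * r * hz
  rw [key]
  exact Subring.mul_mem _ (Subring.mul_mem _ hr (intCast_mem _ z)) (inv_sixteen_pow_mem hp _)

theorem binomSum_sub_eq {q M : ℕ} (hp : p = 2 * q + 1) :
    binomSum (p * M + q) - (jacobiSym 2 p : ℚ) * binomSum M =
      ∑ j ∈ oddsLE (2 * M + 1), (jacobiSym 2 p : ℚ) * jacobiSym 2 j *
        (nodeWeight (p * (2 * M + 1)) (p * j) - nodeWeight (2 * M + 1) j) +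
      ∑ j ∈ oddsLE (p * (2 * M + 1)) with ¬ p ∣ j,
        (jacobiSym 2 j : ℚ) * nodeWeight (p * (2 * M + 1)) j := by
  have hpr : p.Prime := Fact.out
  have hN := (odd_mul_odd_eq hp M).symm
  rw [binomSum_eq_sum_nodeWeight, binomSum_eq_sum_nodeWeight, hN,
    ← Finset.sum_filter_add_sum_filter_not _ (p ∣ ·), filter_dvd_oddsLE ⟨q, hp⟩,
    Finset.sum_image fun a _ b _ h => Nat.eq_of_mul_eq_mul_left hpr.pos h,
    add_sub_right_comm, Finset.mul_sum, ← Finset.sum_sub_distrib]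
  congr 1
  refine Finset.sum_congr rfl fun j hj => ?_
  have hj0 : j ≠ 0 := by
    rintro rfl
    exact absurd (mem_oddsLE.1 hj).2 (by decide)
  rw [jacobiSym.mul_right' 2 hpr.ne_zero hj0]
  push_cast
  ring

end

theorem mainTheorem4 (p : ℕ) (hp : p.Prime) (hp2 : Odd p) (m : ℕ) (hm : Odd m) :
    RatModEq (p ^ 2)
      (1 / ((m : ℚ) ^ 2 * ((m - 1).choose ((m - 1) / 2) : ℚ)) *
        (binomSum ((p * m - 1) / 2) - (jacobiSym 2 p : ℚ) * binomSum ((m - 1) / 2)))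
      0 := by
  have : Fact p.Prime := ⟨hp⟩
  obtain ⟨M, rfl⟩ := hm
  obtain ⟨q, hq⟩ := id hp2
  have h1 : (p * (2 * M + 1) - 1) / 2 = p * M + q := by
    have := odd_mul_odd_eq hq M
    omega
  have h2 : (2 * M + 1 - 1) / 2 = M := by omega
  have h3 : 2 * M + 1 - 1 = 2 * M := by omega
  have hp0 : (p : ℚ) ≠ 0 := by exact_mod_cast hp.ne_zero
  rw [h1, h2, h3, ← Nat.centralBinom_eq_two_mul_choose]
  -- Integrality is tested after dividing by all of p² m² binom(2M, M), so p may divide m or the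
  -- binomial.
  refine ratModEq_zero_of_mem (q := (binomSum (p * M + q) - (jacobiSym 2 p : ℚ) * binomSum M) /
    ((p : ℚ) ^ 2 * (((2 * M + 1 : ℕ) : ℚ) ^ 2 * M.centralBinom))) ?_ ?_
  · rw [binomSum_sub_eq hq, add_div, Finset.sum_div, Finset.sum_div]
    refine Subring.add_mem _ (Subring.sum_mem _ fun j hj => ?_) (Subring.sum_mem _ fun j hj => ?_)
    · rw [mul_div_assoc]
      exact Subring.mul_mem _ (Subring.mul_mem _ (intCast_mem _ _) (intCast_mem _ _))
        (nodeWeight_sub_div_mem hp2 hj)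
    · obtain ⟨hj, hpj⟩ := Finset.mem_filter.1 hj
      rw [mul_div_assoc]
      exact Subring.mul_mem _ (intCast_mem _ _) (nodeWeight_div_mem hq hj hpj)
  · field_simp
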